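/- Let $n\ge 1$. Let $\mathrm{Tree}(n+1)$ be the set of trees with vertex set $\{0,1,\dots,n\}$, rooted at $0$. For $T\in\mathrm{Tree}(n+1)$, let $\mathrm{inv}(T)$ be the number of pairs $(i,j)$ with $1\le i<j\le n$ such that $j$ lies on the path from $i$ to the root, let $\mathrm{lev}(T)$ be the number of leaves of $T$ (vertices without children), and set $$I_n(q,t)=\sum_{T\in\mathrm{Tree}(n+1)}q^{\mathrm{inv}(T)}\,t^{\mathrm{lev}(T)-1}.$$ For a permutation $w\in\mathfrak S_m$, let $\mathrm{des}(w)$ be the number of indices $i\in\{1,\dots,m-1\}$ with $w(i)>w(i+1)$. Call $w$ simsun if for every $j$, the word obtained from $w(1)w(2)\cdots w(m)$ by deleting all entries greater than $j$ has no three consecutive entries $a,b,c$ with $a>b>c$. Let $\mathrm{Simsun}(m)$ be the set of simsun permutations in $\mathfrak S_m$; in particular, $\mathrm{Simsun}(0)$ consists of the empty permutation, which has no descents. Then $$I_n(-1,t)=\sum_{w\in\mathrm{Simsun}(n-1)}t^{\,n-1-\mathrm{des}(w)}.$$ The identity holds as polynomials in $t$ with integer coefficients; equivalently, it holds for every element $t$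 of every commutative ring. -/

import Mathlib

/-- `j` lies on the path from `i` to the root `0`, in a graph on the vertices `0, …, n`
(in a tree this path is unique). -/
def OnRootPath {n : ℕ} (T : SimpleGraph (Fin (n + 1))) (j i : Fin (n + 1)) : Prop :=
  ∃ p : T.Walk i 0, p.IsPath ∧ j ∈ p.support

/-- In a tree rooted at `0`, the vertex `w` is a child of `v`. -/
def IsChild {n : ℕ} (T : SimpleGraph (Fin (n + 1))) (w v : Fin (n + 1)) : Prop :=
  T.Adj v w ∧ OnRootPath T v w

open Classical in
/-- The number of inversions: pairs `1 ≤ i < j ≤ n` such that `j` lies on the path from `i`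
to the root. -/
noncomputable def treeInv {n : ℕ} (T : SimpleGraph (Fin (n + 1))) : ℕ :=
  (Finset.univ.filter fun p : Fin (n + 1) × Fin (n + 1) =>
    0 < p.1 ∧ p.1 < p.2 ∧ OnRootPath T p.2 p.1).card

open Classical in
/-- The number of leaves of a tree rooted at `0`: a leaf is a vertex without children
(so the root is not a leaf as soon as `n ≥ 1`, even if it has degree one). -/
noncomputable def treeLev {n : ℕ} (T : SimpleGraph (Fin (n + 1))) : ℕ :=
  (Finset.univ.filter fun v : Fin (n + 1) => ∀ w, ¬ IsChild T w v).card

open Classical in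
/-- `Tree(n+1)`: the trees with vertex set `{0, 1, …, n}`, rooted at `0`. -/
noncomputable def rootedTrees (n : ℕ) : Finset (SimpleGraph (Fin (n + 1))) :=
  Finset.univ.filter fun T => T.IsTree

/-- The enumerator `I_n(q,t) = ∑_T q^{inv T} t^{lev T - 1}`, evaluated at elements `q`, `t` of a
commutative ring. A tree has at least one leaf, so the exponent of `t` is not truncated. -/
noncomputable def treeEnumerator {R : Type*} [CommRing R] (n : ℕ) (q t : R) : R :=
  ∑ T ∈ rootedTrees n, q ^ treeInv T * t ^ (treeLev T - 1)

/-- The word `u` has a double descent: three consecutive decreasing entries. -/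
def HasDoubleDescent (u : List ℕ) : Prop :=
  ∃ (i : ℕ) (h : i + 2 < u.length), u[i] > u[i + 1] ∧ u[i + 1] > u[i + 2]

/-- The one-line word `w(1) ⋯ w(m)` of a permutation, with entries in `{1, …, m}`. -/
def permWord {m : ℕ} (w : Equiv.Perm (Fin m)) : List ℕ :=
  List.ofFn fun i => (w i : ℕ) + 1

/-- `w` is simsun: for every `j`, deleting from the word of `w` all entries greater than `j`
leaves a word without double descents. -/
def IsSimsun {m : ℕ} (w : Equiv.Perm (Fin m)) : Prop :=
  ∀ j : ℕ, ¬ HasDoubleDescent ((permWord w).filter fun a => a ≤ j)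

/-- The number of descents of a permutation. -/
def permDes {m : ℕ} (w : Equiv.Perm (Fin m)) : ℕ :=
  (Finset.univ.filter fun i : Fin m =>
    ∃ h : (i : ℕ) + 1 < m, w i > w ⟨(i : ℕ) + 1, h⟩).card

open Classical in
/-- The set of simsun permutations in the symmetric group on `m` letters. -/
noncomputable def simsunPerms (m : ℕ) : Finset (Equiv.Perm (Fin m)) :=
  Finset.univ.filter fun w => IsSimsun w

/-!
A tree rooted at `0` is determined by its ancestor order, that is, by an order on the other vertices
which describes a forest. Splitting off the component of a marked vertex of a forest gives a
convolution. The choice of the root of a component with `k + 1` vertices contributes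
`1 + q + ⋯ + q ^ k`, so at `q = -1` only even `k` survive. Hence the exponential generating function
`F(x)` of the forests satisfies `F' = a F + E F`, where `a = t - 1` and `E` is the even part of `F`.
As `E` is even, `F(-x)` satisfies the same equation with the opposite sign, and so `F(x) F(-x) = 1`.
This turns the equation into the Riccati equation `2 F' = 2 a F + F² + 1`, from which the transport
equation `(1 - a x) F' = 1 + a F + (1 - a²) ∂F/∂t` follows. Its coefficients are the recurrence for
the descent polynomials that comes from inserting the largest letter into simsun permutations.
-/

/-! ### Simsun permutations -/

/-- The word `u` begins with a descent. -/
def StartsWithDescent : List ℕ → Prop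
  | y :: z :: _ => z < y
  | _ => False

open Classical in
/-- The number of letters of a word that are not followed by a smaller letter; for the word of a
permutation of `m` letters it is `m` minus the number of descents. -/
noncomputable def nonDescents : List ℕ → ℕ
  | [] => 0
  | y :: l => nonDescents l + if StartsWithDescent (y :: l) then 0 else 1

theorem startsWithDescent_cons_cons {y z : ℕ} {l : List ℕ} :
    StartsWithDescent (y :: z :: l) ↔ z < y :=
  Iff.rfl

theorem not_hasDoubleDescent_nil : ¬ HasDoubleDescent [] := by
  rintro ⟨i, h, -⟩
  simp at h

theorem hasDoubleDescent_cons (y : ℕ) (l : List ℕ) :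
    HasDoubleDescent (y :: l) ↔
      (StartsWithDescent (y :: l) ∧ StartsWithDescent l) ∨ HasDoubleDescent l := by
  constructor
  · rintro ⟨i, h, h₁, h₂⟩
    cases i with
    | zero =>
      match l, h, h₁, h₂ with
      | z :: w :: r, _, h₁, h₂ => exact Or.inl ⟨h₁, h₂⟩
    | succ i => exact Or.inr ⟨i, Nat.succ_lt_succ_iff.1 h, h₁, h₂⟩
  · rintro (⟨h₁, h₂⟩ | ⟨i, h, h₁, h₂⟩)
    · match l, h₁, h₂ with
      | z :: w :: r, h₁, h₂ => exact ⟨0, by simp, h₁, h₂⟩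
    · exact ⟨i + 1, Nat.succ_lt_succ h, h₁, h₂⟩

section DescentWeight

variable {R : Type*} [CommRing R] (x : R)

open Classical in
/-- The weight of a word: zero if it has a double descent, and otherwise a factor `x` for every
letter that is not followed by a smaller one. -/
noncomputable def descentWeight (l : List ℕ) : R :=
  if HasDoubleDescent l then 0 else x ^ nonDescents l

theorem descentWeight_of_not_hasDoubleDescent {l : List ℕ} (h : ¬ HasDoubleDescent l) :
    descentWeight x l = x ^ nonDescents l :=
  if_neg h

theorem descentWeight_cons_of_not_startsWithDescent {y : ℕ} {l : List ℕ}
    (h : ¬ StartsWithDescent (y :: l)) : descentWeight x (y :: l) = x * descentWeight x l := by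
  have hiff : HasDoubleDescent (y :: l) ↔ HasDoubleDescent l := by simp [hasDoubleDescent_cons, h]
  rw [descentWeight, descentWeight, hiff, nonDescents, if_neg h, pow_succ', mul_ite, mul_zero]

theorem descentWeight_cons_of_startsWithDescent {y : ℕ} {l : List ℕ}
    (h : StartsWithDescent (y :: l)) (hl : ¬ StartsWithDescent l) :
    descentWeight x (y :: l) = descentWeight x l := by
  have hiff : HasDoubleDescent (y :: l) ↔ HasDoubleDescent l := by simp [hasDoubleDescent_cons, hl]
  rw [descentWeight, descentWeight, hiff, nonDescents, if_pos h, add_zero]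

theorem descentWeight_cons_eq_zero {y : ℕ} {l : List ℕ}
    (h : StartsWithDescent (y :: l)) (hl : StartsWithDescent l) : descentWeight x (y :: l) = 0 :=
  if_pos ((hasDoubleDescent_cons y l).2 (Or.inl ⟨h, hl⟩))

theorem not_startsWithDescent_of_mem_permutations'Aux {M z : ℕ} {zs l : List ℕ} (hz : z < M)
    (h : ¬ StartsWithDescent (z :: zs)) (hl : l ∈ List.permutations'Aux M zs) :
    ¬ StartsWithDescent (z :: l) := by
  cases zs with
  | nil =>
    obtain rfl : l = [M] := by simpa only [List.permutations'Aux, List.mem_singleton] using hl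
    exact not_lt.2 hz.le
  | cons a as =>
    simp only [List.permutations'Aux, List.mem_cons, List.mem_map] at hl
    rcases hl with rfl | ⟨l, -, rfl⟩
    · exact not_lt.2 hz.le
    · exact h

theorem sum_descentWeight_permutations'Aux_cons (M y : ℕ) (l : List ℕ) :
    ((List.permutations'Aux M (y :: l)).map (descentWeight x)).sum =
      descentWeight x (M :: y :: l) +
        ((List.permutations'Aux M l).map fun l' => descentWeight x (y :: l')).sum := by
  simp only [List.permutations'Aux, List.map_cons, List.map_map, List.sum_cons, Function.comp_def]

theorem sum_descentWeight_permutations'Aux_of_not_startsWithDescent {M y : ℕ} {l : List ℕ}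
    (hy : y < M) (h : ¬ StartsWithDescent (y :: l)) :
    ((List.permutations'Aux M (y :: l)).map (descentWeight x)).sum =
      descentWeight x (y :: l) +
        x * ((List.permutations'Aux M l).map (descentWeight x)).sum := by
  have hinsert : (List.permutations'Aux M l).map (fun l' => descentWeight x (y :: l')) =
      (List.permutations'Aux M l).map fun l' => x * descentWeight x l' :=
    List.map_congr_left fun l' hl' => descentWeight_cons_of_not_startsWithDescent x
      (not_startsWithDescent_of_mem_permutations'Aux hy h hl')
  rw [sum_descentWeight_permutations'Aux_cons, hinsert, List.sum_map_mul_left,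
    descentWeight_cons_of_startsWithDescent x (startsWithDescent_cons_cons.2 hy) h]

theorem sum_descentWeight_permutations'Aux_of_startsWithDescent {M y z : ℕ} {l : List ℕ}
    (hy : y < M) (hz : z < M) (hyz : StartsWithDescent (y :: z :: l))
    (h : ¬ StartsWithDescent (z :: l)) :
    ((List.permutations'Aux M (y :: z :: l)).map (descentWeight x)).sum =
      (x - 1) * descentWeight x (z :: l) +
        ((List.permutations'Aux M (z :: l)).map (descentWeight x)).sum := by
  have hyM : ¬ StartsWithDescent (y :: M :: z :: l) := not_lt.2 hy.le
  have hMy : StartsWithDescent (M :: y :: z :: l) := hy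
  have hMz : StartsWithDescent (M :: z :: l) := hz
  have hinsert : (List.permutations'Aux M l).map (fun l' => descentWeight x (y :: z :: l')) =
      (List.permutations'Aux M l).map fun l' => descentWeight x (z :: l') :=
    List.map_congr_left fun l' hl' => descentWeight_cons_of_startsWithDescent x hyz
      (not_startsWithDescent_of_mem_permutations'Aux hz h hl')
  rw [sum_descentWeight_permutations'Aux_cons, sum_descentWeight_permutations'Aux_cons,
    descentWeight_cons_eq_zero x hMy hyz, List.permutations'Aux, List.map_cons, List.sum_cons,
    List.map_map, Function.comp_def, hinsert, descentWeight_cons_of_not_startsWithDescent x hyM,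
    descentWeight_cons_of_startsWithDescent x hMz h]
  ring

theorem sum_descentWeight_permutations'Aux {M : ℕ} {l : List ℕ} (hl : ¬ HasDoubleDescent l)
    (hM : ∀ a ∈ l, a < M) :
    ((List.permutations'Aux M l).map (descentWeight x)).sum =
      ((l.length : R) + 1 - nonDescents l) * x ^ (nonDescents l + 1) +
        (2 * (nonDescents l : R) - l.length) * x ^ nonDescents l := by
  induction l with
  | nil =>
    have hdd : ¬ HasDoubleDescent [M] := by
      simp [hasDoubleDescent_cons, StartsWithDescent, not_hasDoubleDescent_nil]
    simp [List.permutations'Aux, descentWeight, hdd, nonDescents, StartsWithDescent]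
  | cons y l ih =>
    have hnot := hl
    rw [hasDoubleDescent_cons, not_or, not_and] at hnot
    obtain ⟨hstart, htail⟩ := hnot
    have hyM : y < M := hM y List.mem_cons_self
    specialize ih htail fun a ha => hM a (List.mem_cons_of_mem y ha)
    by_cases hy : StartsWithDescent (y :: l)
    · cases l with
      | nil => exact hy.elim
      | cons z zs =>
        have hcount : nonDescents (y :: z :: zs) = nonDescents (z :: zs) := by
          rw [nonDescents, if_pos hy, add_zero]
        rw [sum_descentWeight_permutations'Aux_of_startsWithDescent x hyM (hM z (by simp)) hy
          (hstart hy), ih, descentWeight_of_not_hasDoubleDescent x htail, hcount,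
          List.length_cons (a := y)]
        push_cast
        ring
    · rw [sum_descentWeight_permutations'Aux_of_not_startsWithDescent x hyM hy, ih,
        descentWeight_of_not_hasDoubleDescent x hl, nonDescents, if_neg hy, List.length_cons]
      push_cast
      ring

end DescentWeight

/-- The simsun condition for words. -/
def IsSimsunWord (l : List ℕ) : Prop :=
  ∀ j : ℕ, ¬ HasDoubleDescent (l.filter fun a => a ≤ j)

theorem IsSimsunWord.not_hasDoubleDescent {l : List ℕ} (h : IsSimsunWord l) {m : ℕ}
    (hl : ∀ a ∈ l, a ≤ m) : ¬ HasDoubleDescent l := by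
  simpa only [List.filter_eq_self.2 fun a ha => decide_eq_true (hl a ha)] using h m

theorem filter_eq_of_mem_permutations'Aux {α : Type*} {M : α} {p : α → Bool} (hp : p M = false)
    {l l' : List α} (h : l' ∈ List.permutations'Aux M l) : l'.filter p = l.filter p := by
  induction l generalizing l' with
  | nil => simp_all [List.permutations'Aux]
  | cons y ys ih =>
    simp only [List.permutations'Aux, List.mem_cons, List.mem_map] at h
    rcases h with rfl | ⟨l'', h, rfl⟩
    · simp [hp]
    · rw [List.filter_cons, List.filter_cons, ih h]

theorem perm_of_mem_permutations'Aux {α : Type*} {M : α} {l l' : List α}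
    (h : l' ∈ List.permutations'Aux M l) : l'.Perm (M :: l) := by
  induction l generalizing l' with
  | nil => simp_all [List.permutations'Aux]
  | cons y ys ih =>
    simp only [List.permutations'Aux, List.mem_cons, List.mem_map] at h
    rcases h with rfl | ⟨l'', h, rfl⟩
    · rfl
    · exact ((ih h).cons y).trans (List.Perm.swap _ _ _)

theorem isSimsunWord_of_mem_permutations'Aux {m : ℕ} {l l' : List ℕ} (hl : ∀ a ∈ l, a ≤ m)
    (h : l' ∈ List.permutations'Aux (m + 1) l) :
    IsSimsunWord l' ↔ IsSimsunWord l ∧ ¬ HasDoubleDescent l' := by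
  have hl' : ∀ a ∈ l', a ≤ m + 1 := fun a ha => by
    rcases List.mem_cons.1 ((perm_of_mem_permutations'Aux h).mem_iff.1 ha) with rfl | ha
    · exact le_rfl
    · exact (hl a ha).trans m.le_succ
  have hsmall {j : ℕ} (hj : j ≤ m) : l'.filter (fun a => a ≤ j) = l.filter fun a => a ≤ j :=
    filter_eq_of_mem_permutations'Aux (by simpa using hj) h
  refine ⟨fun hs => ⟨fun j => ?_, hs.not_hasDoubleDescent hl'⟩, fun ⟨hs, hdd⟩ j => ?_⟩
  · rcases le_or_gt j m with hj | hj
    · exact hsmall hj ▸ hs j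
    · have hall {k : ℕ} (hk : m ≤ k) : l.filter (fun a => a ≤ k) = l :=
        List.filter_eq_self.2 fun a ha => decide_eq_true ((hl a ha).trans hk)
      rw [hall hj.le, ← hall le_rfl, ← hsmall le_rfl]
      exact hs m
  · rcases le_or_gt j m with hj | hj
    · exact hsmall hj ▸ hs j
    · rwa [List.filter_eq_self.2 fun a ha => decide_eq_true ((hl' a ha).trans hj)]

/-- The word `m, m - 1, …, 1`, so that `List.permutations'` inserts the letters of a permutation in
increasing order. -/
def descendingWord (m : ℕ) : List ℕ :=
  (List.range' 1 m).reverse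

theorem descendingWord_succ (m : ℕ) : descendingWord (m + 1) = (m + 1) :: descendingWord m := by
  rw [descendingWord, List.range'_1_concat, List.reverse_concat, descendingWord, add_comm 1]

theorem nodup_descendingWord (m : ℕ) : (descendingWord m).Nodup :=
  List.nodup_reverse.2 List.nodup_range'

theorem length_descendingWord (m : ℕ) : (descendingWord m).length = m := by
  simp [descendingWord]

theorem mem_descendingWord {m a : ℕ} : a ∈ descendingWord m ↔ 1 ≤ a ∧ a ≤ m := by
  simp [descendingWord, add_comm 1]

theorem permWord_injective (m : ℕ) : Function.Injective (permWord (m := m)) := fun w w' h => by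
  ext i
  simpa using congrFun (List.ofFn_injective h) i

theorem permWord_perm_descendingWord {m : ℕ} (w : Equiv.Perm (Fin m)) :
    (permWord w).Perm (descendingWord m) := by
  have hnodup : (permWord w).Nodup :=
    List.nodup_ofFn.2 fun i j h => w.injective (Fin.ext (Nat.succ_injective h))
  refine (List.subperm_of_subset hnodup fun a ha => ?_).perm_of_length_le ?_
  · obtain ⟨i, rfl⟩ := List.mem_ofFn.1 ha
    exact mem_descendingWord.2 ⟨by omega, by omega⟩
  · rw [length_descendingWord, permWord, List.length_ofFn]

theorem sum_permWord {M : Type*} [AddCommMonoid M] (m : ℕ) (g : List ℕ → M) :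
    ∑ w : Equiv.Perm (Fin m), g (permWord w) =
      ((List.permutations' (descendingWord m)).map g).sum := by
  classical
  have hperm := List.permutations_perm_permutations' (descendingWord m)
  have hnodup : (List.permutations' (descendingWord m)).Nodup :=
    hperm.nodup_iff.1 (List.nodup_permutations _ (nodup_descendingWord m))
  have himage : Finset.univ.image (permWord (m := m)) =
      (List.permutations' (descendingWord m)).toFinset := by
    refine Finset.eq_of_subset_of_card_le (Finset.image_subset_iff.2 fun w _ => ?_) ?_
    · exact List.mem_toFinset.2 (List.mem_permutations'.2 (permWord_perm_descendingWord w))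
    · rw [List.toFinset_card_of_nodup hnodup, ← hperm.length_eq, List.length_permutations,
        length_descendingWord, Finset.card_image_of_injective _ (permWord_injective m),
        Finset.card_univ, Fintype.card_perm, Fintype.card_fin]
  rw [← List.sum_toFinset _ hnodup, ← himage,
    Finset.sum_image fun w _ w' _ h => permWord_injective m h]

theorem nonDescents_ofFn_add_card_descents {m : ℕ} (f : Fin m → ℕ) :
    nonDescents (List.ofFn f) +
      (Finset.univ.filter fun i : Fin m =>
        ∃ h : (i : ℕ) + 1 < m, f ⟨(i : ℕ) + 1, h⟩ < f i).card = m := by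
  induction m with
  | zero => simp [nonDescents]
  | succ m ih =>
    have hstart : StartsWithDescent (f 0 :: List.ofFn fun i => f i.succ) ↔
        ∃ h : 0 + 1 < m + 1, f ⟨0 + 1, h⟩ < f 0 := by
      cases m with
      | zero => exact iff_of_false id fun ⟨h, _⟩ => absurd h (by simp)
      | succ m =>
        rw [List.ofFn_succ]
        exact ⟨fun h => ⟨by simp, h⟩, fun ⟨_, h⟩ => h⟩
    have hsucc := ih fun i => f i.succ
    simp only [Fin.succ_mk] at hsucc
    rw [List.ofFn_succ, nonDescents, Fin.card_filter_univ_succ]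
    simp only [hstart, Fin.val_zero, Fin.val_succ, Nat.succ_lt_succ_iff]
    split_ifs <;> omega

theorem sub_permDes_eq_nonDescents {m : ℕ} (w : Equiv.Perm (Fin m)) :
    m - permDes w = nonDescents (permWord w) := by
  have h := nonDescents_ofFn_add_card_descents fun i => (w i : ℕ) + 1
  simp only [Nat.succ_lt_succ_iff, Fin.val_fin_lt] at h
  exact Nat.sub_eq_of_eq_add h.symm

/-- The enumerator of the simsun permutations of `m` letters by the number of non-descents. -/
noncomputable def simsunPoly {R : Type*} [CommRing R] (m : ℕ) (x : R) : R :=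
  ∑ w ∈ simsunPerms m, x ^ (m - permDes w)

theorem map_simsunPoly {R S : Type*} [CommRing R] [CommRing S] (φ : R →+* S) (m : ℕ) (x : R) :
    φ (simsunPoly m x) = simsunPoly m (φ x) := by
  simp only [simsunPoly, map_sum, map_pow]

open Classical in
/-- The weight of a word in the enumerator of simsun words by the number of non-descents. -/
noncomputable def simsunWeight {R : Type*} [CommRing R] (x : R) (l : List ℕ) : R :=
  if IsSimsunWord l then x ^ nonDescents l else 0

theorem simsunPoly_eq_sum_permutations' {R : Type*} [CommRing R] (m : ℕ) (x : R) :
    simsunPoly m x = ((List.permutations' (descendingWord m)).map (simsunWeight x)).sum := by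
  rw [← sum_permWord, simsunPoly, simsunPerms, Finset.sum_filter]
  exact Finset.sum_congr rfl fun w _ => by rw [sub_permDes_eq_nonDescents]; rfl

theorem simsunPoly_zero {R : Type*} [CommRing R] (x : R) : simsunPoly 0 x = 1 := by
  simp [simsunPoly_eq_sum_permutations', descendingWord, List.permutations', simsunWeight,
    IsSimsunWord, nonDescents, not_hasDoubleDescent_nil]

section Polynomial

open Polynomial

variable {R : Type*} [CommRing R]

theorem sum_simsunWeight_permutations'Aux {m : ℕ} {l : List ℕ} (hl : ∀ a ∈ l, a ≤ m) :
    ((List.permutations'Aux (m + 1) l).map (simsunWeight (X : R[X]))).sum =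
      (((l.length : R[X]) + 1) * X - (l.length : R[X])) * simsunWeight X l +
        (2 - X) * X * derivative (simsunWeight X l) := by
  by_cases hs : IsSimsunWord l
  · have hweight : (List.permutations'Aux (m + 1) l).map (simsunWeight (X : R[X])) =
        (List.permutations'Aux (m + 1) l).map (descentWeight X) :=
      List.map_congr_left fun l' hl' => by
        rw [simsunWeight, descentWeight, isSimsunWord_of_mem_permutations'Aux hl hl']
        by_cases hdd : HasDoubleDescent l' <;> simp [hs, hdd]
    have heuler : X * derivative ((X : R[X]) ^ nonDescents l) =
        (nonDescents l : R[X]) * X ^ nonDescents l := by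
      rw [derivative_X_pow]
      cases nonDescents l with
      | zero => simp
      | succ k =>
        simp only [Nat.cast_add, Nat.cast_one, map_add, map_natCast, map_one, add_tsub_cancel_right]
        ring
    rw [hweight, sum_descentWeight_permutations'Aux _ (hs.not_hasDoubleDescent hl)
      fun a ha => Nat.lt_succ_of_le (hl a ha), simsunWeight, if_pos hs, mul_assoc, heuler]
    ring
  · have hzero : ∀ l' ∈ List.permutations'Aux (m + 1) l, simsunWeight (X : R[X]) l' = 0 :=
      fun l' hl' => if_neg fun h => hs ((isSimsunWord_of_mem_permutations'Aux hl hl').1 h).1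
    rw [List.sum_eq_zero (by simpa using hzero), simsunWeight, if_neg hs, map_zero, mul_zero,
      mul_zero, add_zero]

theorem simsunPoly_succ (m : ℕ) :
    simsunPoly (m + 1) (X : R[X]) =
      (((m : R[X]) + 1) * X - (m : R[X])) * simsunPoly m X +
        (2 - X) * X * derivative (simsunPoly m X) := by
  simp only [simsunPoly_eq_sum_permutations', descendingWord_succ, List.permutations']
  rw [List.map_flatMap, List.flatMap_def, List.sum_flatten, List.map_map, map_list_sum,
    List.map_map, ← List.sum_map_mul_left, ← List.sum_map_mul_left, ← List.sum_map_add]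
  refine congrArg List.sum (List.map_congr_left fun l hl => ?_)
  have hperm := List.mem_permutations'.1 hl
  have hle : ∀ a ∈ l, a ≤ m := fun a ha => (mem_descendingWord.1 (hperm.mem_iff.1 ha)).2
  rw [Function.comp_apply, Function.comp_apply, sum_simsunWeight_permutations'Aux hle,
    hperm.length_eq, length_descendingWord]

end Polynomial

/-! ### A recurrence from a Riccati equation -/

section DifferentialEquations

open PowerSeries
open scoped Nat

/-- The derivation of `A⟦X⟧` that applies `d` to every coefficient. -/
noncomputable def coeffDerivation {R A : Type*} [CommRing R] [CommRing A] [Algebra R A]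
    (d : Derivation R A A) : Derivation R A⟦X⟧ A⟦X⟧ :=
  Derivation.mk'
    { toFun := fun F => PowerSeries.mk fun n => d (coeff n F)
      map_add' := fun F G => by ext; simp
      map_smul' := fun r F => by ext; simp }
    fun F G => by
      ext n
      have hswap := Finset.Nat.sum_antidiagonal_swap (n := n)
        (f := fun p => coeff p.1 G * d (coeff p.2 F))
      simp [coeff_mul, Finset.sum_add_distrib, ← hswap]

variable {A : Type*} [CommRing A]

theorem coeff_coeffDerivation {R : Type*} [CommRing R] [Algebra R A] (d : Derivation R A A)
    (F : A⟦X⟧) (n : ℕ) : coeff n (coeffDerivation d F) = d (coeff n F) := by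
  simp [coeffDerivation]

theorem coeffDerivation_C {R : Type*} [CommRing R] [Algebra R A] (d : Derivation R A A) (a : A) :
    coeffDerivation d (C a) = C (d a) := by
  ext n
  rw [coeff_coeffDerivation, coeff_C, coeff_C]
  split_ifs <;> simp

theorem derivative_coeffDerivation {R : Type*} [CommRing R] [Algebra R A] (d : Derivation R A A)
    (F : A⟦X⟧) : d⁄dX A (coeffDerivation d F) = coeffDerivation d (d⁄dX A F) := by
  ext n
  simp [coeff_derivative, coeff_coeffDerivation, mul_comm]

theorem derivative_rescale (r : A) (F : A⟦X⟧) :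
    d⁄dX A (rescale r F) = C r * rescale r (d⁄dX A F) := by
  ext n
  simp only [coeff_derivative, coeff_rescale, coeff_C_mul]
  ring

theorem rescale_C (r a : A) : rescale r (C a) = C a := by
  ext n
  rw [coeff_rescale, coeff_C]
  split_ifs with h <;> simp [h]

theorem eq_zero_of_derivative_eq_mul [IsAddTorsionFree A] {F G : A⟦X⟧}
    (h0 : constantCoeff F = 0) (h : d⁄dX A F = G * F) : F = 0 := by
  ext n
  induction n using Nat.strong_induction_on with
  | _ n ih =>
    cases n with
    | zero => simpa using h0
    | succ n =>
      have hn : coeff n (G * F) = 0 := by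
        rw [coeff_mul]
        refine Finset.sum_eq_zero fun p hp => ?_
        rw [ih p.2 (by have := Finset.HasAntidiagonal.mem_antidiagonal.1 hp; omega),
          map_zero, mul_zero]
      rw [← h, coeff_derivative, mul_comm, ← Nat.cast_succ, ← nsmul_eq_mul] at hn
      exact (smul_eq_zero.1 hn).resolve_left n.succ_ne_zero

variable [Algebra ℚ A]

/-- The exponential generating function `∑ f n Xⁿ / n!` of a sequence. -/
noncomputable def egf : (ℕ → A) →ₗ[A] A⟦X⟧ where
  toFun f := PowerSeries.mk fun n => (n ! : ℚ)⁻¹ • f n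
  map_add' f g := by ext; simp
  map_smul' a f := by ext; simp

theorem coeff_egf (f : ℕ → A) (n : ℕ) : coeff n (egf f) = (n ! : ℚ)⁻¹ • f n := by
  simp [egf]

theorem constantCoeff_egf (f : ℕ → A) : constantCoeff (egf f) = f 0 := by
  simp [← coeff_zero_eq_constantCoeff_apply, coeff_egf]

theorem derivative_egf (f : ℕ → A) : d⁄dX A (egf f) = egf fun n => f (n + 1) := by
  ext n
  have hn : ((n + 1)! : ℚ)⁻¹ * ((n : ℚ) + 1) = (n ! : ℚ)⁻¹ := by
    rw [Nat.factorial_succ]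
    push_cast
    field_simp
  have hcast : (n : A) + 1 = algebraMap ℚ A (n + 1) := by simp
  rw [coeff_derivative, coeff_egf, coeff_egf, ← hn, hcast, mul_comm, ← Algebra.smul_def, smul_smul,
    mul_comm]

theorem X_mul_derivative_egf (f : ℕ → A) : X * d⁄dX A (egf f) = egf fun n => n * f n := by
  ext n
  cases n with
  | zero => simp [coeff_egf]
  | succ n =>
    rw [coeff_succ_X_mul, coeff_derivative, coeff_egf, coeff_egf, smul_mul_assoc, mul_comm,
      Nat.cast_succ]

theorem rescale_neg_one_egf (f : ℕ → A) :
    rescale (-1) (egf f) = egf fun n => (-1) ^ n * f n := by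
  ext n
  rw [coeff_rescale, coeff_egf, coeff_egf, mul_smul_comm]

theorem coeffDerivation_egf (d : Derivation ℚ A A) (f : ℕ → A) :
    coeffDerivation d (egf f) = egf fun n => d (f n) := by
  ext n
  rw [coeff_coeffDerivation, coeff_egf, coeff_egf, d.map_smul]

theorem egf_mul_egf (f g : ℕ → A) :
    egf f * egf g =
      egf fun n => ∑ p ∈ Finset.HasAntidiagonal.antidiagonal n,
        (n.choose p.1 : A) * f p.1 * g p.2 := by
  ext n
  rw [coeff_mul, coeff_egf, Finset.smul_sum]
  refine Finset.sum_congr rfl fun p hp => ?_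
  obtain rfl := Finset.HasAntidiagonal.mem_antidiagonal.1 hp
  have hchoose : ((p.1 + p.2)! : ℚ)⁻¹ * ((p.1 + p.2).choose p.1 : ℚ) =
      (p.1 ! : ℚ)⁻¹ * (p.2 ! : ℚ)⁻¹ := by
    rw [Nat.cast_add_choose]
    field_simp
  have hcast : ((p.1 + p.2).choose p.1 : A) =
      algebraMap ℚ A ((p.1 + p.2).choose p.1) := by simp
  rw [coeff_egf, coeff_egf, smul_mul_smul_comm, ← hchoose, hcast, mul_assoc, ← Algebra.smul_def,
    smul_smul]

theorem mul_rescale_neg_one_eq_one {F E : A⟦X⟧} {a : A} (h0 : constantCoeff F = 1)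
    (hE : rescale (-1) E = E) (hF : d⁄dX A F = C a * F + E * F) :
    F * rescale (-1) F = 1 := by
  have := IsAddTorsionFree.of_module_rat A
  have hc : constantCoeff (rescale (-1) F) = 1 := by
    rw [← coeff_zero_eq_constantCoeff_apply, coeff_rescale, coeff_zero_eq_constantCoeff_apply, h0,
      pow_zero, mul_one]
  refine derivative.ext ?_ (by rw [map_mul, hc, h0, mul_one, map_one])
  have hG : d⁄dX A (rescale (-1) F) = -(C a + E) * rescale (-1) F := by
    rw [derivative_rescale, hF]
    simp only [map_add, map_mul, map_neg, map_one, rescale_C, hE]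
    ring
  rw [Derivation.leibniz, hF, hG, derivative_one]
  simp only [smul_eq_mul]
  ring

/-- The defect of the transport equation solves a homogeneous linear equation in `X`, so it
vanishes as soon as its constant term does. -/
theorem transport_of_riccati {F : A⟦X⟧} {a : A} (d : Derivation ℚ A A) (hd : d a = 1)
    (h0 : constantCoeff F = 1) (hF : 2 * d⁄dX A F = 2 * C a * F + F ^ 2 + 1) :
    d⁄dX A F - C a * (X * d⁄dX A F) =
      1 + C a * F + (1 - C a ^ 2) * coeffDerivation d F := by
  have := IsAddTorsionFree.of_module_rat A
  have half : (C (algebraMap ℚ A 2⁻¹) : A⟦X⟧) * 2 = 1 := by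
    rw [← map_ofNat (C (R := A)), ← map_ofNat (algebraMap ℚ A), ← map_mul, ← map_mul]
    simp
  have hD2 (D : Derivation ℚ A⟦X⟧ A⟦X⟧) : D 2 = 0 := D.map_natCast 2
  have hC : coeffDerivation d (C a) = 1 := by rw [coeffDerivation_C, hd, map_one]
  set F' := d⁄dX A F with hF'
  set Fₜ := coeffDerivation d F with hFₜ
  have hF'' : d⁄dX A F' = C a * F' + F * F' := by
    have e := congrArg (d⁄dX A) hF
    have h2 : d⁄dX A (2 : A⟦X⟧) = 0 := (d⁄dX A).map_natCast 2
    simp only [Derivation.leibniz, map_add, h2, derivative_C, Derivation.map_one_eq_zero, pow_two,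
      smul_eq_mul, ← hF'] at e
    linear_combination C (algebraMap ℚ A 2⁻¹) * e + (C a * F' + F * F' - d⁄dX A F') * half
  have hFₜ' : d⁄dX A Fₜ = C a * Fₜ + F + F * Fₜ := by
    have e := congrArg (coeffDerivation d) hF
    simp only [Derivation.leibniz, map_add, hD2, hC, Derivation.map_one_eq_zero, pow_two,
      smul_eq_mul, ← hFₜ, ← derivative_coeffDerivation, hF'] at e
    linear_combination C (algebraMap ℚ A 2⁻¹) * e + (C a * Fₜ + F + F * Fₜ - d⁄dX A Fₜ) * half
  rw [← sub_eq_zero]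
  apply eq_zero_of_derivative_eq_mul (G := C a + F)
  · have e := congrArg constantCoeff hF
    have ed : constantCoeff Fₜ = 0 := by
      rw [← coeff_zero_eq_constantCoeff_apply, hFₜ, coeff_coeffDerivation,
        coeff_zero_eq_constantCoeff_apply, h0, Derivation.map_one_eq_zero]
    have half₀ := congrArg constantCoeff half
    simp only [map_add, map_sub, map_mul, map_pow, constantCoeff_C, constantCoeff_X, h0, ed,
      map_one, map_ofNat] at e half₀ ⊢
    linear_combination algebraMap ℚ A 2⁻¹ * e + (1 + a - constantCoeff F') * half₀
  · simp only [map_sub, map_add, Derivation.leibniz, Derivation.map_one_eq_zero, derivative_C,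
      pow_two, smul_eq_mul, derivative_X, hF'', hFₜ', ← hF']
    linear_combination -C a * hF

theorem derivative_recurrence_of_even_convolution (d : Derivation ℚ A A) {a : A}
    (hd : d a = 1) {f : ℕ → A} (h0 : f 0 = 1)
    (hf : ∀ n, f (n + 1) = a * f n + ∑ p ∈ Finset.HasAntidiagonal.antidiagonal n,
      (n.choose p.1 : A) * (if Even p.1 then f p.1 else 0) * f p.2) (n : ℕ) :
    f (n + 2) = (n + 2) * a * f (n + 1) + (1 - a ^ 2) * d (f (n + 1)) := by
  set e : ℕ → A := fun k => if Even k then f k else 0 with he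
  have hconst : constantCoeff (egf f) = 1 := by rw [constantCoeff_egf, h0]
  have hderiv : d⁄dX A (egf f) = C a * egf f + egf e * egf f := by
    rw [derivative_egf, egf_mul_egf, ← smul_eq_C_mul, ← map_smul, ← map_add]
    exact congrArg egf (funext hf)
  have heven : egf f + rescale (-1) (egf f) = 2 * egf e := by
    rw [rescale_neg_one_egf, ← map_add, two_mul, ← map_add]
    congr 1
    ext k
    rcases Nat.even_or_odd k with hk | hk
    · simp [he, hk, hk.neg_one_pow]
    · simp [he, Nat.not_even_iff_odd.2 hk, hk.neg_one_pow]
  have hrescale : rescale (-1) (egf e) = egf e := by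
    rw [rescale_neg_one_egf]
    congr 1
    ext k
    by_cases hk : Even k
    · simp [hk.neg_one_pow]
    · simp [he, hk]
  have hmul := mul_rescale_neg_one_eq_one hconst hrescale hderiv
  have hriccati : 2 * d⁄dX A (egf f) = 2 * C a * egf f + egf f ^ 2 + 1 := by
    linear_combination 2 * hderiv - egf f * heven + hmul
  have hpde := transport_of_riccati d hd hconst hriccati
  rw [X_mul_derivative_egf, derivative_egf, coeffDerivation_egf, ← map_one C, ← map_pow,
    ← map_sub, ← smul_eq_C_mul, ← smul_eq_C_mul, ← smul_eq_C_mul, ← map_smul, ← map_smul,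
    ← map_smul, ← map_sub, add_assoc, ← map_add] at hpde
  have hcoeff := congrArg (coeff (n + 1)) hpde
  rw [map_add, coeff_C, if_neg n.succ_ne_zero, zero_add, coeff_egf, coeff_egf] at hcoeff
  have hn := smul_right_injective A
    (inv_ne_zero (Nat.cast_ne_zero.2 (n + 1).factorial_ne_zero)) hcoeff
  simp only [Pi.sub_apply, Pi.add_apply, Pi.smul_apply, smul_eq_mul, Nat.cast_add,
    Nat.cast_one] at hn
  linear_combination hn

end DifferentialEquations

/-! ### Forests as orders -/

/-- A rooted forest on the vertex set `V`, encoded by the set `A` of the pairs `(i, j)` such that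
`j` is a proper ancestor of `i`: a strict partial order in which the elements above a given one form
a chain. -/
structure IsForestOrder {α : Type*} (V : Finset α) (A : Finset (α × α)) : Prop where
  subset : A ⊆ V ×ˢ V
  irrefl : ∀ i, (i, i) ∉ A
  trans : ∀ {i j k}, (i, j) ∈ A → (j, k) ∈ A → (i, k) ∈ A
  chain : ∀ {i j k}, (i, j) ∈ A → (i, k) ∈ A → j = k ∨ (j, k) ∈ A ∨ (k, j) ∈ A

/-- A forest that is a tree with root `r`. -/
structure IsTreeOrder {α : Type*} (V : Finset α) (r : α) (A : Finset (α × α)) : Prop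
    extends IsForestOrder V A where
  root_mem : r ∈ V
  below_root : ∀ {i}, i ∈ V → i ≠ r → (i, r) ∈ A

section ForestOrder

variable {α : Type*} {V W : Finset α} {A B : Finset (α × α)} {M r : α}

namespace IsForestOrder

theorem left_mem (h : IsForestOrder V A) {i j : α} (hij : (i, j) ∈ A) : i ∈ V :=
  (Finset.mem_product.1 (h.subset hij)).1

theorem right_mem (h : IsForestOrder V A) {i j : α} (hij : (i, j) ∈ A) : j ∈ V :=
  (Finset.mem_product.1 (h.subset hij)).2

theorem ne (h : IsForestOrder V A) {i j : α} (hij : (i, j) ∈ A) : i ≠ j := by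
  rintro rfl
  exact h.irrefl i hij

theorem asymm (h : IsForestOrder V A) {i j : α} (hij : (i, j) ∈ A) : (j, i) ∉ A := fun hji =>
  h.irrefl i (h.trans hij hji)

theorem disjoint (hA : IsForestOrder V A) (hB : IsForestOrder W B) (hVW : Disjoint V W) :
    Disjoint A B :=
  (Finset.disjoint_product.2 (Or.inl hVW)).mono hA.subset hB.subset

open Classical in
theorem card_below_lt (h : IsForestOrder V A) {i j : α} (hij : (i, j) ∈ A) :
    (V.filter fun k => (k, i) ∈ A).card < (V.filter fun k => (k, j) ∈ A).card := by
  refine Finset.card_lt_card (Finset.ssubset_iff_of_subset ?_ |>.2 ⟨i, ?_, ?_⟩)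
  · exact Finset.monotone_filter_right V fun k _ hk => h.trans hk hij
  · exact Finset.mem_filter.2 ⟨h.left_mem hij, hij⟩
  · exact fun hi => h.irrefl i (Finset.mem_filter.1 hi).2

theorem exists_leaf (h : IsForestOrder V A) (hV : V.Nonempty) : ∃ v ∈ V, ∀ u, (u, v) ∉ A := by
  classical
  obtain ⟨v, hv, hmin⟩ :=
    Finset.exists_min_image V (fun v => (V.filter fun k => (k, v) ∈ A).card) hV
  exact ⟨v, hv, fun u hu => (h.card_below_lt hu).not_ge (hmin u (h.left_mem hu))⟩

theorem exists_root (h : IsForestOrder V A) (hM : M ∈ V) :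
    ∃ r ∈ V, (M = r ∨ (M, r) ∈ A) ∧ ∀ j, (r, j) ∉ A := by
  classical
  obtain ⟨r, hr, hmax⟩ := Finset.exists_max_image (V.filter fun r => M = r ∨ (M, r) ∈ A)
    (fun r => (V.filter fun k => (k, r) ∈ A).card) ⟨M, by simp [hM]⟩
  obtain ⟨hrV, hMr⟩ := Finset.mem_filter.1 hr
  refine ⟨r, hrV, hMr, fun j hj => (h.card_below_lt hj).not_ge (hmax j ?_)⟩
  refine Finset.mem_filter.2 ⟨h.right_mem hj, Or.inr ?_⟩
  rcases hMr with rfl | hMr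
  · exact hj
  · exact h.trans hMr hj

variable [DecidableEq α]

theorem restrict (h : IsForestOrder V A) (S : Finset α) : IsForestOrder S (A ∩ S ×ˢ S) where
  subset := Finset.inter_subset_right
  irrefl i hi := h.irrefl i (Finset.mem_of_mem_inter_left hi)
  trans hij hjk := by
    simp only [Finset.mem_inter, Finset.mem_product] at *
    exact ⟨h.trans hij.1 hjk.1, hij.2.1, hjk.2.2⟩
  chain hij hik := by
    simp only [Finset.mem_inter, Finset.mem_product] at *
    have := h.chain hij.1 hik.1
    tauto

theorem union (hA : IsForestOrder V A) (hB : IsForestOrder W B) (hVW : Disjoint V W) :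
    IsForestOrder (V ∪ W) (A ∪ B) where
  subset := Finset.union_subset
    (hA.subset.trans (Finset.product_subset_product Finset.subset_union_left
      Finset.subset_union_left))
    (hB.subset.trans (Finset.product_subset_product Finset.subset_union_right
      Finset.subset_union_right))
  irrefl i hi := (Finset.mem_union.1 hi).elim (hA.irrefl i) (hB.irrefl i)
  trans hij hjk := by
    rw [Finset.disjoint_left] at hVW
    rcases Finset.mem_union.1 hij with hij | hij <;> rcases Finset.mem_union.1 hjk with hjk | hjk
    · exact Finset.mem_union_left _ (hA.trans hij hjk)
    · exact (hVW (hA.right_mem hij) (hB.left_mem hjk)).elim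
    · exact (hVW (hA.left_mem hjk) (hB.right_mem hij)).elim
    · exact Finset.mem_union_right _ (hB.trans hij hjk)
  chain hij hik := by
    rw [Finset.disjoint_left] at hVW
    simp only [Finset.mem_union]
    rcases Finset.mem_union.1 hij with hij | hij <;> rcases Finset.mem_union.1 hik with hik | hik
    · have := hA.chain hij hik
      tauto
    · exact (hVW (hA.left_mem hij) (hB.left_mem hik)).elim
    · exact (hVW (hA.left_mem hik) (hB.left_mem hij)).elim
    · have := hB.chain hij hik
      tauto

theorem union_inter_left (hA : IsForestOrder V A) (hB : IsForestOrder W B) (hVW : Disjoint V W) :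
    (A ∪ B) ∩ V ×ˢ V = A := by
  have hBV : Disjoint B (V ×ˢ V) :=
    (Finset.disjoint_product.2 (Or.inl hVW.symm)).mono_left hB.subset
  rw [Finset.union_inter_distrib_right, Finset.inter_eq_left.2 hA.subset,
    Finset.disjoint_iff_inter_eq_empty.1 hBV, Finset.union_empty]

theorem cone (h : IsForestOrder V A) (hr : r ∉ V) :
    IsTreeOrder (insert r V) r (A ∪ V ×ˢ {r}) where
  subset := Finset.union_subset
    (h.subset.trans (Finset.product_subset_product (Finset.subset_insert r V)
      (Finset.subset_insert r V)))
    (Finset.product_subset_product (Finset.subset_insert r V) (by simp))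
  irrefl i hi := by
    simp only [Finset.mem_union, Finset.mem_product, Finset.mem_singleton] at hi
    rcases hi with hi | ⟨hi, rfl⟩
    · exact h.irrefl i hi
    · exact hr hi
  trans {i j k} hij hjk := by
    simp only [Finset.mem_union, Finset.mem_product, Finset.mem_singleton] at *
    rcases hij with hij | ⟨-, rfl⟩ <;> rcases hjk with hjk | ⟨hj, rfl⟩
    · exact Or.inl (h.trans hij hjk)
    · exact Or.inr ⟨h.left_mem hij, rfl⟩
    · exact (hr (h.left_mem hjk)).elim
    · exact (hr hj).elim
  chain {i j k} hij hik := by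
    simp only [Finset.mem_union, Finset.mem_product, Finset.mem_singleton] at *
    rcases hij with hij | ⟨-, rfl⟩ <;> rcases hik with hik | ⟨-, rfl⟩
    · have := h.chain hij hik
      tauto
    · exact Or.inr (Or.inl (Or.inr ⟨h.right_mem hij, rfl⟩))
    · exact Or.inr (Or.inr (Or.inr ⟨h.right_mem hik, rfl⟩))
    · exact Or.inl rfl
  root_mem := Finset.mem_insert_self r V
  below_root hi hir := Finset.mem_union_right _
    (Finset.mem_product.2 ⟨Finset.mem_of_mem_insert_of_ne hi hir, Finset.mem_singleton_self r⟩)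

theorem cone_inter (h : IsForestOrder V A) (hr : r ∉ V) : (A ∪ V ×ˢ {r}) ∩ V ×ˢ V = A := by
  have hrV : Disjoint (V ×ˢ {r}) (V ×ˢ V) :=
    Finset.disjoint_product.2 (Or.inr (Finset.disjoint_singleton_left.2 hr))
  rw [Finset.union_inter_distrib_right, Finset.inter_eq_left.2 h.subset,
    Finset.disjoint_iff_inter_eq_empty.1 hrV, Finset.union_empty]

/-- Restricting a forest to the cone below the maximal element `r` above `M` and to its complement
splits off the component of `M`. -/
theorem exists_component (h : IsForestOrder V A) (hM : M ∈ V) :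
    ∃ S ⊆ V, M ∈ S ∧ ∃ r, IsTreeOrder S r (A ∩ S ×ˢ S) ∧
      A ∩ S ×ˢ S ∪ A ∩ (V \ S) ×ˢ (V \ S) = A := by
  obtain ⟨r, hr, hMr, hmax⟩ := h.exists_root hM
  set S := V.filter fun i => i = r ∨ (i, r) ∈ A with hS
  have hmem {i j : α} (hij : (i, j) ∈ A) : i ∈ S ↔ j ∈ S := by
    simp only [hS, Finset.mem_filter, h.left_mem hij, h.right_mem hij, true_and]
    constructor
    · rintro (rfl | hir)
      · exact (hmax j hij).elim
      · rcases h.chain hij hir with hjr | hjr | hrj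
        · exact Or.inl hjr
        · exact Or.inr hjr
        · exact (hmax j hrj).elim
    · rintro (rfl | hjr)
      · exact Or.inr hij
      · exact Or.inr (h.trans hij hjr)
  refine ⟨S, Finset.filter_subset _ V, Finset.mem_filter.2 ⟨hM, hMr⟩, r,
    { h.restrict S with
      root_mem := Finset.mem_filter.2 ⟨hr, Or.inl rfl⟩
      below_root := fun {i} hi hir => ?_ }, ?_⟩
  · have hrS : r ∈ S := Finset.mem_filter.2 ⟨hr, Or.inl rfl⟩
    exact Finset.mem_inter.2 ⟨(Finset.mem_filter.1 hi).2.resolve_left hir,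
      Finset.mem_product.2 ⟨hi, hrS⟩⟩
  · ext ⟨i, j⟩
    simp only [Finset.mem_union, Finset.mem_inter, Finset.mem_product, Finset.mem_sdiff]
    constructor
    · tauto
    · intro hij
      have := hmem hij
      have := h.left_mem hij
      have := h.right_mem hij
      tauto

end IsForestOrder

namespace IsTreeOrder

theorem root_left_notMem (h : IsTreeOrder V r A) (j : α) : (r, j) ∉ A := fun hj =>
  h.asymm hj (h.below_root (h.right_mem hj) (h.ne hj).symm)

variable [DecidableEq α]

theorem mem_iff_of_union (hA : IsTreeOrder V r A) (hB : IsForestOrder W B) (hVW : Disjoint V W)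
    {i : α} : i ∈ V ↔ i = r ∨ (i, r) ∈ A ∪ B := by
  refine ⟨fun hi => ?_, ?_⟩
  · by_cases hir : i = r
    · exact Or.inl hir
    · exact Or.inr (Finset.mem_union_left _ (hA.below_root hi hir))
  · rintro (rfl | hi)
    · exact hA.root_mem
    · rcases Finset.mem_union.1 hi with hi | hi
      · exact hA.left_mem hi
      · exact (Finset.disjoint_left.1 hVW hA.root_mem (hB.right_mem hi)).elim

theorem eq_cone (h : IsTreeOrder V r A) :
    A ∩ V.erase r ×ˢ V.erase r ∪ V.erase r ×ˢ {r} = A := by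
  ext ⟨i, j⟩
  simp only [Finset.mem_union, Finset.mem_inter, Finset.mem_product, Finset.mem_erase,
    Finset.mem_singleton]
  constructor
  · rintro (hij | ⟨hi, rfl⟩)
    · exact hij.1
    · exact h.below_root hi.2 hi.1
  · intro hij
    have hi : i ≠ r := by
      rintro rfl
      exact h.root_left_notMem j hij
    by_cases hj : j = r
    · exact Or.inr ⟨⟨hi, h.left_mem hij⟩, hj⟩
    · exact Or.inl ⟨hij, ⟨hi, h.left_mem hij⟩, hj, h.right_mem hij⟩

end IsTreeOrder

end ForestOrder

section Enumerators

open Classical in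
/-- The rooted forests on the vertex set `V`. -/
noncomputable def forestOrders {α : Type*} (V : Finset α) : Finset (Finset (α × α)) :=
  (V ×ˢ V).powerset.filter fun A => IsForestOrder V A

open Classical in
/-- The trees on the vertex set `V` with root `r`. -/
noncomputable def treeOrders {α : Type*} (V : Finset α) (r : α) : Finset (Finset (α × α)) :=
  (V ×ˢ V).powerset.filter fun A => IsTreeOrder V r A

theorem mem_forestOrders {α : Type*} {V : Finset α} {A : Finset (α × α)} :
    A ∈ forestOrders V ↔ IsForestOrder V A := by
  classical
  rw [forestOrders, Finset.mem_filter, Finset.mem_powerset, and_iff_right_of_imp fun h => h.subset]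

theorem mem_treeOrders {α : Type*} {V : Finset α} {r : α} {A : Finset (α × α)} :
    A ∈ treeOrders V r ↔ IsTreeOrder V r A := by
  classical
  rw [treeOrders, Finset.mem_filter, Finset.mem_powerset, and_iff_right_of_imp fun h => h.subset]

open Classical in
/-- The number of leaves of a forest on `V`. -/
noncomputable def forestLev {α : Type*} (V : Finset α) (A : Finset (α × α)) : ℕ :=
  (V.filter fun v => ∀ u, (u, v) ∉ A).card

theorem IsForestOrder.forestLev_pos {α : Type*} {V : Finset α} {A : Finset (α × α)}
    (h : IsForestOrder V A) (hV : V.Nonempty) : 0 < forestLev V A := by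
  classical
  obtain ⟨v, hv, hleaf⟩ := h.exists_leaf hV
  exact Finset.card_pos.2 ⟨v, Finset.mem_filter.2 ⟨hv, hleaf⟩⟩

variable {α : Type*} [LinearOrder α]

/-- The number of inversions of a forest: pairs `i < j` such that `j` is an ancestor of `i`. -/
def forestInv (A : Finset (α × α)) : ℕ :=
  (A.filter fun p => p.1 < p.2).card

variable {R : Type*} [CommRing R] (q t : R) {V W : Finset α} {A B : Finset (α × α)} {M r : α}

/-- The term `q ^ inv * t ^ lev` of a forest in the enumerators. -/
noncomputable def forestWeight (V : Finset α) (A : Finset (α × α)) : R :=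
  q ^ forestInv A * t ^ forestLev V A

/-- The enumerator of the forests on `V` by inversions and leaves. -/
noncomputable def forestSum (V : Finset α) : R :=
  ∑ A ∈ forestOrders V, forestWeight q t V A

/-- The enumerator of the trees on `V` with root `r` by inversions and leaves. -/
noncomputable def treeSum (V : Finset α) (r : α) : R :=
  ∑ A ∈ treeOrders V r, forestWeight q t V A

theorem forestWeight_union (hA : IsForestOrder V A) (hB : IsForestOrder W B)
    (hVW : Disjoint V W) :
    forestWeight q t (V ∪ W) (A ∪ B) = forestWeight q t V A * forestWeight q t W B := by
  classical
  have hinv : forestInv (A ∪ B) = forestInv A + forestInv B := by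
    rw [forestInv, Finset.filter_union,
      Finset.card_union_of_disjoint (Finset.disjoint_filter_filter (hA.disjoint hB hVW))]
    rfl
  have hV : V.filter (fun v => ∀ u, (u, v) ∉ A ∪ B) = V.filter fun v => ∀ u, (u, v) ∉ A :=
    Finset.filter_congr fun v hv => forall_congr' fun u => by
      rw [Finset.notMem_union, and_iff_left fun h => Finset.disjoint_left.1 hVW hv (hB.right_mem h)]
  have hW : W.filter (fun v => ∀ u, (u, v) ∉ A ∪ B) = W.filter fun v => ∀ u, (u, v) ∉ B :=
    Finset.filter_congr fun v hv => forall_congr' fun u => by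
      rw [Finset.notMem_union,
        and_iff_right fun h => Finset.disjoint_left.1 hVW (hA.right_mem h) hv]
  have hlev : forestLev (V ∪ W) (A ∪ B) = forestLev V A + forestLev W B := by
    rw [forestLev, Finset.filter_union,
      Finset.card_union_of_disjoint (Finset.disjoint_filter_filter hVW), hV, hW]
    rfl
  rw [forestWeight, hinv, hlev, pow_add, pow_add, mul_mul_mul_comm]
  rfl

theorem forestInv_cone (hA : IsForestOrder V A) (hr : r ∉ V) :
    forestInv (A ∪ V ×ˢ {r}) = (V.filter fun i => i < r).card + forestInv A := by
  have hdisj : Disjoint A (V ×ˢ {r}) := Disjoint.mono_left hA.subset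
    (Finset.disjoint_product.2 (Or.inr (Finset.disjoint_singleton_right.2 hr)))
  have hcone : (V ×ˢ {r}).filter (fun p => p.1 < p.2) = V.filter (fun i => i < r) ×ˢ {r} := by
    ext ⟨i, j⟩
    simp only [Finset.mem_filter, Finset.mem_product, Finset.mem_singleton]
    constructor
    · rintro ⟨⟨hi, rfl⟩, hij⟩
      exact ⟨⟨hi, hij⟩, rfl⟩
    · rintro ⟨⟨hi, hij⟩, rfl⟩
      exact ⟨⟨hi, rfl⟩, hij⟩
  rw [forestInv, Finset.filter_union,
    Finset.card_union_of_disjoint (Finset.disjoint_filter_filter hdisj), hcone,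
    Finset.card_product, Finset.card_singleton, mul_one, add_comm]
  rfl

theorem forestLev_cone (hA : IsForestOrder V A) (hr : r ∉ V) :
    forestLev (insert r V) (A ∪ V ×ˢ {r}) = (if V = ∅ then 1 else 0) + forestLev V A := by
  classical
  have hroot : (∀ u, (u, r) ∉ A ∪ V ×ˢ {r}) ↔ V = ∅ := by
    rw [Finset.eq_empty_iff_forall_notMem]
    refine forall_congr' fun u => ?_
    rw [Finset.notMem_union, and_iff_right fun h => hr (hA.right_mem h)]
    simp
  have hV : V.filter (fun v => ∀ u, (u, v) ∉ A ∪ V ×ˢ {r}) = V.filter fun v => ∀ u, (u, v) ∉ A :=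
    Finset.filter_congr fun v hv => forall_congr' fun u => by
      rw [Finset.notMem_union, and_iff_left]
      simpa using fun _ => (ne_of_mem_of_not_mem hv hr).symm
  simp only [forestLev, Finset.filter_insert, hroot, hV]
  split_ifs
  · rw [Finset.card_insert_of_notMem fun h => hr (Finset.mem_filter.1 h).1, add_comm]
  · rw [zero_add]

theorem treeSum_eq_mul_forestSum_erase (hr : r ∈ V) :
    treeSum q t V r = q ^ (V.filter fun i => i < r).card *
      ((if V.card = 1 then t else 1) * forestSum q t (V.erase r)) := by
  have hne := Finset.notMem_erase r V
  have hinsert := Finset.insert_erase hr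
  have hcard : V.card = 1 ↔ V.erase r = ∅ := by
    rw [← Finset.card_eq_zero, Finset.card_erase_of_mem hr]
    have := Finset.card_pos.2 ⟨r, hr⟩
    omega
  have hless : V.filter (fun i => i < r) = (V.erase r).filter fun i => i < r := by
    conv_lhs => rw [← hinsert, Finset.filter_insert, if_neg (lt_irrefl r)]
  have hweight {A : Finset (α × α)} (hA : IsForestOrder (V.erase r) A) :
      forestWeight q t V (A ∪ V.erase r ×ˢ {r}) = q ^ (V.filter fun i => i < r).card *
        ((if V.card = 1 then t else 1) * forestWeight q t (V.erase r) A) := by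
    have hlev := forestLev_cone hA hne
    rw [hinsert] at hlev
    rw [forestWeight, forestInv_cone hA hne, hlev, hless, pow_add, pow_add, pow_ite, pow_one,
      pow_zero, forestWeight]
    simp only [hcard]
    ring
  rw [treeSum, forestSum, Finset.mul_sum, Finset.mul_sum]
  refine Finset.sum_bij' (fun A _ => A ∩ V.erase r ×ˢ V.erase r) (fun A _ => A ∪ V.erase r ×ˢ {r})
    (fun A hA => mem_forestOrders.2 ((mem_treeOrders.1 hA).restrict _))
    (fun A hA => mem_treeOrders.2 (by simpa only [hinsert] using (mem_forestOrders.1 hA).cone hne))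
    (fun A hA => (mem_treeOrders.1 hA).eq_cone)
    (fun A hA => (mem_forestOrders.1 hA).cone_inter hne) (fun A hA => ?_)
  rw [← hweight ((mem_treeOrders.1 hA).restrict _), (mem_treeOrders.1 hA).eq_cone]

theorem IsTreeOrder.eq_of_union_eq {S S' : Finset α} {r' : α} {A' B' : Finset (α × α)}
    (hM : M ∈ S) (hM' : M ∈ S') (hA : IsTreeOrder S r A) (hA' : IsTreeOrder S' r' A')
    (hB : IsForestOrder (V \ S) B) (hB' : IsForestOrder (V \ S') B') (h : A ∪ B = A' ∪ B') :
    S = S' ∧ r = r' := by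
  have hmem {i : α} : i ∈ S ↔ i = r ∨ (i, r) ∈ A ∪ B :=
    hA.mem_iff_of_union hB Finset.disjoint_sdiff
  have hmem' {i : α} : i ∈ S' ↔ i = r' ∨ (i, r') ∈ A ∪ B := by
    rw [h, hA'.mem_iff_of_union hB' Finset.disjoint_sdiff]
  have hmax (j : α) : (r, j) ∉ A ∪ B := by
    rw [Finset.notMem_union]
    exact ⟨hA.root_left_notMem j, fun hj => (Finset.mem_sdiff.1 (hB.left_mem hj)).2 hA.root_mem⟩
  have hr : r ∈ S' := by
    rcases hmem.1 hM with rfl | hMr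
    · exact hM'
    · rw [h] at hMr
      rcases Finset.mem_union.1 hMr with hMr | hMr
      · exact hA'.right_mem hMr
      · exact ((Finset.mem_sdiff.1 (hB'.left_mem hMr)).2 hM').elim
  obtain rfl : r = r' := (hmem'.1 hr).resolve_right (hmax r')
  exact ⟨Finset.ext fun i => hmem.trans hmem'.symm, rfl⟩

theorem forestSum_eq_sum_component (hM : M ∈ V) :
    forestSum q t V = ∑ S ∈ V.powerset with M ∈ S,
      (∑ r ∈ S, treeSum q t S r) * forestSum q t (V \ S) := by
  simp only [forestSum, treeSum, Finset.sum_mul]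
  simp only [Finset.mul_sum, Finset.sum_sigma']
  symm
  refine Finset.sum_bij (fun x _ => x.2.2.1 ∪ x.2.2.2) ?_ ?_ ?_ ?_
  all_goals simp only [Finset.mem_sigma, Finset.mem_filter, Finset.mem_powerset, mem_treeOrders,
    mem_forestOrders]
  · rintro ⟨S, r, A, B⟩ ⟨⟨hS, -⟩, -, hA, hB⟩
    simpa only [Finset.union_sdiff_of_subset hS] using
      hA.toIsForestOrder.union hB Finset.disjoint_sdiff
  · rintro ⟨S, r, A, B⟩ ⟨⟨-, hMS⟩, -, hA, hB⟩ ⟨S', r', A', B'⟩ ⟨⟨-, hMS'⟩, -, hA', hB'⟩ h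
    dsimp only at hMS hA hB hMS' hA' hB' h
    obtain ⟨rfl, rfl⟩ := hA.eq_of_union_eq hMS hMS' hA' hB hB' h
    have hdisj : Disjoint S (V \ S) := Finset.disjoint_sdiff
    obtain rfl : A = A' := by
      rw [← hA.union_inter_left hB hdisj, h, hA'.union_inter_left hB' hdisj]
    obtain rfl : B = B' := by
      rw [← hB.union_inter_left hA.toIsForestOrder hdisj.symm, Finset.union_comm, h,
        Finset.union_comm, hB'.union_inter_left hA.toIsForestOrder hdisj.symm]
    rfl
  · intro F hF
    obtain ⟨S, hS, hMS, r, hA, hunion⟩ := hF.exists_component hM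
    exact ⟨⟨S, r, _, _⟩, ⟨⟨hS, hMS⟩, hA.root_mem, hA, hF.restrict _⟩, hunion⟩
  · rintro ⟨S, r, A, B⟩ ⟨⟨hS, -⟩, -, hA, hB⟩
    rw [← forestWeight_union q t hA.toIsForestOrder hB Finset.disjoint_sdiff,
      Finset.union_sdiff_of_subset hS]

theorem sum_card_filter_lt {N : Type*} [AddCommMonoid N] (S : Finset α) (g : ℕ → N) :
    ∑ r ∈ S, g (S.filter fun i => i < r).card = ∑ k ∈ Finset.range S.card, g k := by
  induction S using Finset.induction_on_max with
  | empty => simp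
  | insert a S ha ih =>
    have haS : a ∉ S := fun h => (ha a h).false
    have hbelow : (insert a S).filter (fun i => i < a) = S := by
      rw [Finset.filter_insert, if_neg (lt_irrefl a), Finset.filter_true_of_mem ha]
    have hrest : ∀ r ∈ S, (insert a S).filter (fun i => i < r) = S.filter fun i => i < r :=
      fun r hr => by rw [Finset.filter_insert, if_neg (ha r hr).le.not_gt]
    rw [Finset.sum_insert haS, hbelow, Finset.sum_congr rfl fun r hr => by rw [hrest r hr], ih,
      Finset.card_insert_of_notMem haS, Finset.sum_range_succ, add_comm]

theorem sum_neg_one_pow_card_filter_lt (S : Finset α) :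
    ∑ r ∈ S, (-1 : R) ^ (S.filter fun i => i < r).card = if Even S.card then 0 else 1 := by
  rw [sum_card_filter_lt S fun k => (-1 : R) ^ k, neg_one_geom_sum]

/-- The number of forests on `n` vertices, counted with the weight `(-1) ^ inv * t ^ lev`. In the
recursion `k` is the number of vertices other than the root in the component of a marked vertex. -/
noncomputable def alternatingForestSum (t : R) : ℕ → R
  | 0 => 1
  | n + 1 => ∑ k : Fin (n + 1), (n.choose k : R) *
      ((if (k : ℕ) = 0 then t else 1) * (if Even (k : ℕ) then alternatingForestSum t k else 0) *
        alternatingForestSum t (n - k))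

theorem forestSum_empty : forestSum q t (∅ : Finset α) = 1 := by
  have h : forestOrders (∅ : Finset α) = {∅} := by
    ext A
    rw [mem_forestOrders, Finset.mem_singleton]
    refine ⟨fun hA => Finset.subset_empty.1 (by simpa using hA.subset), ?_⟩
    rintro rfl
    constructor <;> simp
  simp [forestSum, h, forestWeight, forestInv, forestLev]

theorem sum_powerset_filter_mem {N : Type*} [AddCommMonoid N] (hM : M ∈ V) (g : Finset α → N) :
    ∑ S ∈ V.powerset with M ∈ S, g S = ∑ U ∈ (V.erase M).powerset, g (insert M U) := by
  refine Finset.sum_bij' (fun S _ => S.erase M) (fun U _ => insert M U) ?_ ?_ ?_ ?_ ?_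
  all_goals simp only [Finset.mem_filter, Finset.mem_powerset]
  · exact fun S hS => Finset.erase_subset_erase M hS.1
  · exact fun U hU => ⟨Finset.insert_subset hM (hU.trans (Finset.erase_subset M V)),
      Finset.mem_insert_self M U⟩
  · exact fun S hS => Finset.insert_erase hS.2
  · exact fun U hU => Finset.erase_insert fun h => Finset.notMem_erase M V (hU h)
  · exact fun S hS => by rw [Finset.insert_erase hS.2]

theorem sum_treeSum_neg_one {S : Finset α} {n : ℕ} (hcard : S.card = n + 1)
    (ih : ∀ r ∈ S, forestSum (-1) t (S.erase r) = alternatingForestSum t n) :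
    ∑ r ∈ S, treeSum (-1) t S r =
      (if n = 0 then t else 1) * if Even n then alternatingForestSum t n else 0 := by
  have hterm : ∀ r ∈ S, treeSum (-1) t S r = (-1) ^ (S.filter fun i => i < r).card *
      ((if n = 0 then t else 1) * alternatingForestSum t n) := fun r hr => by
    simp only [treeSum_eq_mul_forestSum_erase _ _ hr, ih r hr, hcard, Nat.add_eq_right]
  rw [Finset.sum_congr rfl hterm, ← Finset.sum_mul, sum_neg_one_pow_card_filter_lt, hcard]
  simp only [Nat.even_add_one]
  split_ifs <;> simp

theorem forestSum_neg_one (V : Finset α) :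
    forestSum (-1) t V = alternatingForestSum t V.card := by
  induction hn : V.card using Nat.strong_induction_on generalizing V with
  | _ n ih =>
  subst hn
  obtain rfl | ⟨M, hM⟩ := V.eq_empty_or_nonempty
  · rw [forestSum_empty, Finset.card_empty, alternatingForestSum]
  obtain ⟨m, hm⟩ : ∃ m, (V.erase M).card = m := ⟨_, rfl⟩
  have hcard : V.card = m + 1 := by rw [← hm, Finset.card_erase_add_one hM]
  have hterm : ∀ U ∈ (V.erase M).powerset,
      (∑ r ∈ insert M U, treeSum (-1) t (insert M U) r) * forestSum (-1) t (V \ insert M U) =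
        (if U.card = 0 then t else 1) *
          (if Even U.card then alternatingForestSum t U.card else 0) *
            alternatingForestSum t (m - U.card) := by
    intro U hU
    rw [Finset.mem_powerset] at hU
    have hUm : U.card ≤ m := hm ▸ Finset.card_le_card hU
    have hMU : (insert M U).card = U.card + 1 :=
      Finset.card_insert_of_notMem fun h => Finset.notMem_erase M V (hU h)
    have hrest : (V \ insert M U).card = m - U.card := by
      rw [Finset.sdiff_insert, ← Finset.erase_sdiff_comm, Finset.card_sdiff_of_subset hU, hm]
    rw [ih _ (by omega) _ hrest, sum_treeSum_neg_one t hMU fun r hr => ih _ (by omega) _ ?_]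
    rw [Finset.card_erase_of_mem hr, hMU, Nat.add_sub_cancel]
  rw [forestSum_eq_sum_component _ _ hM, sum_powerset_filter_mem hM, Finset.sum_congr rfl hterm,
    Finset.sum_powerset_apply_card fun k => (if k = 0 then t else 1) *
      (if Even k then alternatingForestSum t k else 0) * alternatingForestSum t (m - k), hcard,
    alternatingForestSum, hm, Finset.sum_range]
  simp only [nsmul_eq_mul]

theorem alternatingForestSum_succ (n : ℕ) :
    alternatingForestSum t (n + 1) = (t - 1) * alternatingForestSum t n +
      ∑ p ∈ Finset.HasAntidiagonal.antidiagonal n, (n.choose p.1 : R) *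
        (if Even p.1 then alternatingForestSum t p.1 else 0) * alternatingForestSum t p.2 := by
  rw [Finset.Nat.sum_antidiagonal_eq_sum_range_succ fun i j => (n.choose i : R) *
    (if Even i then alternatingForestSum t i else 0) * alternatingForestSum t j,
    alternatingForestSum, Fin.sum_univ_succ, Finset.sum_range, Fin.sum_univ_succ]
  have h0 : alternatingForestSum t 0 = 1 := by rw [alternatingForestSum]
  simp only [Fin.coe_ofNat_eq_mod, Nat.zero_mod, Nat.choose_zero_right, Nat.cast_one, ↓reduceIte,
    Even.zero, h0, mul_one, tsub_zero, one_mul, Fin.val_succ, Nat.add_eq_zero_iff, one_ne_zero,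
    and_false, mul_ite, mul_zero, ite_mul, zero_mul, Nat.succ_eq_add_one, mul_assoc]
  ring

end Enumerators

/-! ### Trees rooted at the vertex zero -/

section RootPath

variable {n : ℕ} {T : SimpleGraph (Fin (n + 1))} {i j k u v w : Fin (n + 1)}

theorem onRootPath_iff_mem_support (hT : T.IsTree) {p : T.Walk i 0} (hp : p.IsPath) :
    OnRootPath T j i ↔ j ∈ p.support := by
  refine ⟨?_, fun h => ⟨p, hp, h⟩⟩
  rintro ⟨q, hq, hj⟩
  rwa [(hT.existsUnique_path i 0).unique hp hq]

theorem onRootPath_refl (hT : T.IsTree) (i : Fin (n + 1)) : OnRootPath T i i := by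
  obtain ⟨p, hp⟩ := (hT.existsUnique_path i 0).exists
  exact ⟨p, hp, p.start_mem_support⟩

theorem onRootPath_zero (hT : T.IsTree) (i : Fin (n + 1)) : OnRootPath T 0 i := by
  obtain ⟨p, hp⟩ := (hT.existsUnique_path i 0).exists
  exact ⟨p, hp, p.end_mem_support⟩

theorem OnRootPath.eq_zero (h : OnRootPath T j 0) : j = 0 := by
  obtain ⟨p, hp, hj⟩ := h
  rw [SimpleGraph.Walk.isPath_iff_nil, ← SimpleGraph.Walk.eq_nil_iff_nil] at hp
  simpa [hp] using hj

theorem isChild_of_isPath_cons {p : T.Walk u 0} {h : T.Adj v u}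
    (hp : (SimpleGraph.Walk.cons h p).IsPath) : IsChild T v u :=
  ⟨h.symm, _, hp, List.mem_cons_of_mem _ p.start_mem_support⟩

theorem IsChild.exists_isPath_cons (hT : T.IsTree) (h : IsChild T w v) :
    ∃ p : T.Walk v 0, (SimpleGraph.Walk.cons h.1.symm p).IsPath := by
  obtain ⟨hadj, p, hp, hv⟩ := h
  have hsnd := hT.isAcyclic.eq_snd_of_adj_start hp hadj.symm hv
  cases p with
  | nil => exact (hadj.ne (by simpa using hv)).elim
  | cons h p =>
    rw [SimpleGraph.Walk.snd_cons] at hsnd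
    subst hsnd
    exact ⟨p, hp⟩

theorem IsChild.onRootPath_iff (hT : T.IsTree) (h : IsChild T w v) :
    OnRootPath T u w ↔ u = w ∨ OnRootPath T u v := by
  obtain ⟨p, hp⟩ := h.exists_isPath_cons hT
  rw [onRootPath_iff_mem_support hT hp, onRootPath_iff_mem_support hT hp.of_cons,
    SimpleGraph.Walk.support_cons, List.mem_cons]

theorem IsChild.not_onRootPath (hT : T.IsTree) (h : IsChild T w v) : ¬OnRootPath T w v := by
  obtain ⟨p, hp⟩ := h.exists_isPath_cons hT
  rw [onRootPath_iff_mem_support hT hp.of_cons]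
  exact ((SimpleGraph.Walk.cons_isPath_iff _ p).1 hp).2

theorem exists_isChild_of_ne_zero (hT : T.IsTree) (hv : v ≠ 0) : ∃ u, IsChild T v u := by
  obtain ⟨p, hp⟩ := (hT.existsUnique_path v 0).exists
  cases p with
  | nil => exact (hv rfl).elim
  | cons h p => exact ⟨_, isChild_of_isPath_cons hp⟩

theorem root_induction (hT : T.IsTree) {motive : Fin (n + 1) → Prop} (root : motive 0)
    (child : ∀ w v, IsChild T w v → motive v → motive w) (v : Fin (n + 1)) : motive v := by
  have hpath {v z : Fin (n + 1)} (p : T.Walk v z) (hp : p.IsPath) (hz : z = 0) : motive v := by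
    induction p with
    | nil => rwa [hz]
    | cons h p ih =>
      subst hz
      exact child _ _ (isChild_of_isPath_cons hp) (ih hp.of_cons rfl)
  obtain ⟨p, hp⟩ := (hT.existsUnique_path v 0).exists
  exact hpath p hp rfl

theorem adj_iff_isChild (hT : T.IsTree) : T.Adj u v ↔ IsChild T u v ∨ IsChild T v u := by
  refine ⟨fun h => ?_, fun h => h.elim (fun h => h.1.symm) fun h => h.1⟩
  obtain ⟨p, hp⟩ := (hT.existsUnique_path u 0).exists
  by_cases hv : v ∈ p.support
  · exact Or.inl ⟨h.symm, p, hp, hv⟩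
  · exact Or.inr (isChild_of_isPath_cons (hp.cons (h := h.symm) hv))

theorem OnRootPath.trans (hT : T.IsTree) (hij : OnRootPath T j i) (hjk : OnRootPath T k j) :
    OnRootPath T k i := by
  induction i using root_induction hT with
  | root => rwa [← hij.eq_zero]
  | child w v hwv ih =>
    rcases (hwv.onRootPath_iff hT).1 hij with rfl | hij
    · exact hjk
    · exact (hwv.onRootPath_iff hT).2 (Or.inr (ih hij))

theorem OnRootPath.antisymm (hT : T.IsTree) (hij : OnRootPath T j i) (hji : OnRootPath T i j) :
    i = j := by
  by_cases hi : i = 0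
  · subst hi
    exact hij.eq_zero.symm
  · obtain ⟨v, hv⟩ := exists_isChild_of_ne_zero hT hi
    rcases (hv.onRootPath_iff hT).1 hij with rfl | hjv
    · rfl
    · exact (hv.not_onRootPath hT (hjv.trans hT hji)).elim

theorem OnRootPath.total (hT : T.IsTree) (hj : OnRootPath T j i) (hk : OnRootPath T k i) :
    OnRootPath T k j ∨ OnRootPath T j k := by
  induction i using root_induction hT with
  | root => exact Or.inl (by rw [hk.eq_zero]; exact onRootPath_zero hT j)
  | child w v hwv ih =>
    rcases (hwv.onRootPath_iff hT).1 hj with rfl | hjv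
    · exact Or.inl hk
    · rcases (hwv.onRootPath_iff hT).1 hk with rfl | hkv
      · exact Or.inr hj
      · exact ih hjv hkv

theorem OnRootPath.exists_isChild (hT : T.IsTree) (h : OnRootPath T v i) (hiv : i ≠ v) :
    ∃ w, IsChild T w v := by
  induction i using root_induction hT with
  | root => exact (hiv h.eq_zero.symm).elim
  | child w u hwu ih =>
    by_cases huv : u = v
    · exact ⟨w, huv ▸ hwu⟩
    · exact ih (((hwu.onRootPath_iff hT).1 h).resolve_left hiv.symm) huv

theorem isChild_iff_onRootPath (hT : T.IsTree) :
    IsChild T w v ↔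
      v ≠ w ∧ OnRootPath T v w ∧ ∀ u, u ≠ w → OnRootPath T u w → OnRootPath T u v := by
  constructor
  · exact fun h => ⟨h.1.ne, h.2, fun u huw hu => ((h.onRootPath_iff hT).1 hu).resolve_left huw⟩
  · rintro ⟨hvw, hv, hmin⟩
    have hw : w ≠ 0 := by
      rintro rfl
      exact hvw hv.eq_zero
    obtain ⟨u, hu⟩ := exists_isChild_of_ne_zero hT hw
    have hvu : OnRootPath T v u := ((hu.onRootPath_iff hT).1 hv).resolve_left hvw
    rwa [← hvu.antisymm hT (hmin u hu.1.ne hu.2)]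

end RootPath

section TreeOrder

variable {n : ℕ} {T T' : SimpleGraph (Fin (n + 1))} {i j : Fin (n + 1)}

open Classical in
/-- The proper ancestor relation of a tree rooted at `0`. -/
noncomputable def treeOrder (T : SimpleGraph (Fin (n + 1))) : Finset (Fin (n + 1) × Fin (n + 1)) :=
  Finset.univ.filter fun p => p.1 ≠ p.2 ∧ OnRootPath T p.2 p.1

theorem mem_treeOrder : (i, j) ∈ treeOrder T ↔ i ≠ j ∧ OnRootPath T j i := by
  simp [treeOrder]

theorem isTreeOrder_treeOrder (hT : T.IsTree) : IsTreeOrder Finset.univ 0 (treeOrder T) where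
  subset := by simp
  irrefl i hi := (mem_treeOrder.1 hi).1 rfl
  trans {i j k} hij hjk := by
    rw [mem_treeOrder] at *
    refine ⟨?_, hij.2.trans hT hjk.2⟩
    rintro rfl
    exact hij.1 (hij.2.antisymm hT hjk.2)
  chain {i j k} hij hik := by
    simp only [mem_treeOrder] at *
    have := hij.2.total hT hik.2
    tauto
  root_mem := Finset.mem_univ 0
  below_root {i} _ hi := mem_treeOrder.2 ⟨hi, onRootPath_zero hT i⟩

theorem onRootPath_iff_mem_treeOrder (hT : T.IsTree) :
    OnRootPath T j i ↔ j = i ∨ (i, j) ∈ treeOrder T := by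
  rw [mem_treeOrder]
  constructor
  · tauto
  · rintro (rfl | h)
    · exact onRootPath_refl hT j
    · exact h.2

theorem eq_of_treeOrder_eq (hT : T.IsTree) (hT' : T'.IsTree) (h : treeOrder T = treeOrder T') :
    T = T' := by
  ext u v
  simp only [adj_iff_isChild hT, adj_iff_isChild hT', isChild_iff_onRootPath hT,
    isChild_iff_onRootPath hT', onRootPath_iff_mem_treeOrder hT, onRootPath_iff_mem_treeOrder hT',
    h]

theorem treeInv_eq_forestInv (T : SimpleGraph (Fin (n + 1))) :
    treeInv T = forestInv (treeOrder T) := by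
  classical
  rw [treeInv, forestInv, treeOrder, Finset.filter_filter]
  congr 1 with ⟨i, j⟩
  simp only [Finset.mem_filter, Finset.mem_univ, true_and]
  constructor
  · rintro ⟨-, hij, h⟩
    exact ⟨⟨hij.ne, h⟩, hij⟩
  · rintro ⟨⟨hne, h⟩, hij⟩
    refine ⟨Fin.pos_of_ne_zero ?_, hij, h⟩
    rintro rfl
    exact hne h.eq_zero.symm

theorem treeLev_eq_forestLev (hT : T.IsTree) :
    treeLev T = forestLev Finset.univ (treeOrder T) := by
  classical
  rw [treeLev, forestLev]
  congr 1 with v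
  simp only [Finset.mem_filter, Finset.mem_univ, true_and, mem_treeOrder]
  constructor
  · rintro hv i ⟨hiv, hi⟩
    obtain ⟨w, hw⟩ := hi.exists_isChild hT hiv
    exact hv w hw
  · exact fun hv w hw => hv w ⟨hw.1.ne', hw.2⟩

end TreeOrder

section ParentGraph

variable {α : Type*} {r : α} {par : α → α}

/-- The graph in which every vertex `v` other than `r` is joined to its parent `par v`. -/
def parentGraph (r : α) (par : α → α) : SimpleGraph α :=
  SimpleGraph.fromRel fun v u => v ≠ r ∧ par v = u

theorem isTree_parentGraph [Finite α] (h : (parentGraph r par).Connected) :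
    (parentGraph r par).IsTree := by
  classical
  have := Fintype.ofFinite α
  refine SimpleGraph.isTree_iff_connected_and_card.2
    ⟨h, le_antisymm ?_ h.card_vert_le_card_edgeSet_add_one⟩
  have hsub :
      (parentGraph r par).edgeFinset ⊆ (Finset.univ.erase r).image fun v => s(v, par v) := by
    intro e
    induction e using Sym2.ind with
    | _ u v =>
      rw [SimpleGraph.mem_edgeFinset, SimpleGraph.mem_edgeSet, parentGraph,
        SimpleGraph.fromRel_adj]
      rintro ⟨-, ⟨hu, rfl⟩ | ⟨hv, rfl⟩⟩
      · exact Finset.mem_image.2 ⟨u, by simp [hu], rfl⟩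
      · exact Finset.mem_image.2 ⟨v, by simp [hv], Sym2.eq_swap⟩
  have hcard := (Finset.card_le_card hsub).trans Finset.card_image_le
  have hpos := Fintype.card_pos_iff.2 ⟨r⟩
  rw [Finset.card_erase_of_mem (Finset.mem_univ r), Finset.card_univ] at hcard
  rw [Nat.card_eq_fintype_card, Nat.card_eq_fintype_card, ← SimpleGraph.edgeFinset_card]
  omega

theorem IsForestOrder.exists_parent {V : Finset α} {A : Finset (α × α)} (h : IsForestOrder V A)
    {v w : α} (hvw : (v, w) ∈ A) : ∃ u, ∀ j, (v, j) ∈ A ↔ j = u ∨ (u, j) ∈ A := by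
  classical
  obtain ⟨u, hu, hmin⟩ := Finset.exists_min_image (V.filter fun u => (v, u) ∈ A)
    (fun u => (V.filter fun k => (k, u) ∈ A).card)
    ⟨w, Finset.mem_filter.2 ⟨h.right_mem hvw, hvw⟩⟩
  replace hu := (Finset.mem_filter.1 hu).2
  refine ⟨u, fun j => ⟨fun hj => ?_, ?_⟩⟩
  · rcases h.chain hu hj with huj | huj | hju
    · exact Or.inl huj.symm
    · exact Or.inr huj
    · exact ((h.card_below_lt hju).not_ge
        (hmin j (Finset.mem_filter.2 ⟨h.right_mem hj, hj⟩))).elim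
  · rintro (rfl | huj)
    · exact hu
    · exact h.trans hu huj

theorem IsTreeOrder.exists_isPath_parentGraph [Fintype α] {A : Finset (α × α)}
    (h : IsTreeOrder Finset.univ r A)
    (hpar : ∀ v, v ≠ r → ∀ j, (v, j) ∈ A ↔ j = par v ∨ (par v, j) ∈ A) (v : α) :
    ∃ p : (parentGraph r par).Walk v r, p.IsPath ∧ ∀ w, w ∈ p.support ↔ w = v ∨ (v, w) ∈ A := by
  have : IsTrans α fun u v => (v, u) ∈ A := ⟨fun _ _ _ huv hvw => h.trans hvw huv⟩
  have : Std.Irrefl fun u v => (v, u) ∈ A := ⟨h.irrefl⟩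
  induction v using (Finite.wellFounded_of_trans_of_irrefl fun u v => (v, u) ∈ A).induction with
  | _ v ih =>
  by_cases hv : v = r
  · subst hv
    exact ⟨.nil, .nil, fun w => by simp [h.root_left_notMem]⟩
  · have hmem : (v, par v) ∈ A := (hpar v hv _).2 (Or.inl rfl)
    have hadj : (parentGraph r par).Adj v (par v) :=
      (SimpleGraph.fromRel_adj _ _ _).2 ⟨h.ne hmem, Or.inl ⟨hv, rfl⟩⟩
    obtain ⟨p, hp, hsupp⟩ := ih (par v) hmem
    refine ⟨.cons hadj p, hp.cons fun hvp => ?_, fun w => ?_⟩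
    · exact h.irrefl v ((hpar v hv v).2 ((hsupp v).1 hvp))
    · rw [SimpleGraph.Walk.support_cons, List.mem_cons, hsupp, ← hpar v hv]

theorem exists_isTree_treeOrder_eq {n : ℕ} {A : Finset (Fin (n + 1) × Fin (n + 1))}
    (hA : IsTreeOrder Finset.univ 0 A) :
    ∃ T : SimpleGraph (Fin (n + 1)), T.IsTree ∧ treeOrder T = A := by
  have hparent (v : Fin (n + 1)) : ∃ u, v ≠ 0 → ∀ j, (v, j) ∈ A ↔ j = u ∨ (u, j) ∈ A := by
    by_cases hv : v = 0
    · exact ⟨0, fun h => (h hv).elim⟩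
    · obtain ⟨u, hu⟩ := hA.exists_parent (hA.below_root (Finset.mem_univ v) hv)
      exact ⟨u, fun _ => hu⟩
  choose par hpar using hparent
  choose p hp hsupp using hA.exists_isPath_parentGraph hpar
  have hT : (parentGraph 0 par).IsTree := isTree_parentGraph
    ((SimpleGraph.connected_iff_exists_forall_reachable _).2 ⟨0, fun v => (p v).reachable.symm⟩)
  refine ⟨_, hT, Finset.ext fun ⟨i, j⟩ => ?_⟩
  rw [mem_treeOrder, onRootPath_iff_mem_support hT (hp i), hsupp]
  constructor
  · rintro ⟨hij, rfl | h⟩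
    · exact (hij rfl).elim
    · exact h
  · exact fun h => ⟨hA.ne h, Or.inr h⟩

end ParentGraph

section TreeEnumerator

variable {R S : Type*} [CommRing R] [CommRing S] (n : ℕ)

theorem mul_treeEnumerator (q t : R) :
    t * treeEnumerator n q t = treeSum q t Finset.univ (0 : Fin (n + 1)) := by
  classical
  have hmem {T : SimpleGraph (Fin (n + 1))} : T ∈ rootedTrees n ↔ T.IsTree := by simp [rootedTrees]
  rw [treeEnumerator, treeSum, Finset.mul_sum]
  refine Finset.sum_bij (fun T _ => treeOrder T)
    (fun T hT => mem_treeOrders.2 (isTreeOrder_treeOrder (hmem.1 hT)))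
    (fun T hT T' hT' h => eq_of_treeOrder_eq (hmem.1 hT) (hmem.1 hT') h) (fun A hA => ?_)
    fun T hT => ?_
  · obtain ⟨T, hT, h⟩ := exists_isTree_treeOrder_eq (mem_treeOrders.1 hA)
    exact ⟨T, hmem.2 hT, h⟩
  · have hT := hmem.1 hT
    have hlev := (isTreeOrder_treeOrder hT).forestLev_pos Finset.univ_nonempty
    rw [forestWeight, ← treeInv_eq_forestInv, treeLev_eq_forestLev hT, mul_left_comm,
      mul_pow_sub_one hlev.ne']

theorem mul_treeEnumerator_neg_one (hn : n ≠ 0) (t : R) :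
    t * treeEnumerator n (-1) t = alternatingForestSum t n := by
  rw [mul_treeEnumerator, treeSum_eq_mul_forestSum_erase _ _ (Finset.mem_univ 0),
    forestSum_neg_one]
  simp [hn]

theorem map_treeEnumerator (φ : R →+* S) (q t : R) :
    φ (treeEnumerator n q t) = treeEnumerator n (φ q) (φ t) := by
  simp only [treeEnumerator, map_sum, map_mul, map_pow]

end TreeEnumerator

section Comparison

open Polynomial

theorem alternatingForestSum_derivative_recurrence (n : ℕ) :
    alternatingForestSum (X : ℚ[X]) (n + 2) =
      ((n : ℚ[X]) + 2) * (X - 1) * alternatingForestSum X (n + 1) +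
        (1 - (X - 1) ^ 2) * derivative (alternatingForestSum X (n + 1)) := by
  have hd : Polynomial.derivative' (X - 1 : ℚ[X]) = 1 := by simp [derivative'_apply]
  have h0 : alternatingForestSum (X : ℚ[X]) 0 = 1 := by rw [alternatingForestSum]
  exact derivative_recurrence_of_even_convolution derivative' hd h0 (alternatingForestSum_succ X) n

theorem alternatingForestSum_eq_mul_simsunPoly (m : ℕ) :
    alternatingForestSum (X : ℚ[X]) (m + 1) = X * simsunPoly m X := by
  induction m with
  | zero => simp [alternatingForestSum, simsunPoly_zero]
  | succ m ih =>
    rw [alternatingForestSum_derivative_recurrence, ih, simsunPoly_succ, derivative_mul,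
      derivative_X]
    ring

theorem treeEnumerator_X_rat (m : ℕ) :
    treeEnumerator (m + 1) (-1) (X : ℚ[X]) = simsunPoly m X := by
  apply mul_left_cancel₀ (X_ne_zero (R := ℚ))
  rw [mul_treeEnumerator_neg_one _ m.succ_ne_zero, alternatingForestSum_eq_mul_simsunPoly]

theorem treeEnumerator_X_int (m : ℕ) :
    treeEnumerator (m + 1) (-1) (X : ℤ[X]) = simsunPoly m X := by
  apply map_injective (Int.castRingHom ℚ) Int.cast_injective
  simp only [← coe_mapRingHom, map_treeEnumerator, map_simsunPoly, map_neg, map_one]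
  simpa using treeEnumerator_X_rat m

end Comparison

theorem theorem3p5 {R : Type*} [CommRing R] (n : ℕ) (hn : 1 ≤ n) (t : R) :
    treeEnumerator n (-1) t =
      ∑ w ∈ simsunPerms (n - 1), t ^ (n - 1 - permDes w) := by
  obtain ⟨m, rfl⟩ := Nat.exists_eq_add_of_le' hn
  let φ := Polynomial.eval₂RingHom (Int.castRingHom R) t
  calc treeEnumerator (m + 1) (-1) t
      = φ (treeEnumerator (m + 1) (-1) Polynomial.X) := by simp [φ, map_treeEnumerator]
    _ = φ (simsunPoly m Polynomial.X) := by rw [treeEnumerator_X_int]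
    _ = simsunPoly m t := by simp [φ, map_simsunPoly]
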